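/- Let $X=\mathbb C^n$ be a finite-dimensional quantum system (a finite-dimensional complex Hilbert space with a fixed orthonormal basis, so that operators are complex $n\times n$ matrices), and let $R_1,\dots,R_d$ be self-adjoint operators on $X$. A state on a system is a positive semidefinite operator of unit trace. For states $\sigma,\rho$ on $X$, a quantum coupling of $\sigma$ and $\rho$ is a state $\pi$ on $X\otimes X^*$ whose partial traces are $\operatorname{tr}_{X}[\pi]=\sigma^T$ (trace over the first factor) and $\operatorname{tr}_{X^*}[\pi]=\rho$, where $A^T$ denotes the transpose of $A$, acting on $X^*$. Put $$C=\sum_{i=1}^d\bigl(R_i\otimes 1_{X^*}-1_X\otimes R_i^T\bigr)^2 ,\qquad D(\sigma,\rho)=\Bigl(\min_\pi \operatorname{tr}[C\pi]\Bigr)^{1/2},$$ the minimum being over all quantum couplings $\pi$ of $\sigma$ and $\rho$. A quantum transport plan from $\sigma$ to $\rho$ is a completely positive, trace preserving linear map $\Phi$ on the operators on $X$ with $\Phi(\sigma)=\rho$. Its average cost is $\operatorname{tr}[C\pi_\Phi]$, where $\pi_\Phi=(\Phi\otimes\mathrm{id})(|\Psi\rangle\langle\Psi|)$ and $\Psi\in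 X\otimes X^*$ is the canonical purification of $\sigma$, i.e. the vector that corresponds to $\sqrt\sigma$ under the identification $|\varphi\rangle\otimes\langle\psi|\mapsto|\varphi\rangle\langle\psi|$. Then: 1. For all states $\sigma,\rho$ on $X$ the minimum defining $D(\sigma,\rho)^2$ is attained, and $$D(\sigma,\rho)^2\ \ge\ \sum_{i=1}^d\Bigl(\operatorname{tr}[R_i^2\sigma]-\operatorname{tr}[R_i\sqrt\sigma R_i\sqrt\sigma]+\operatorname{tr}[R_i^2\rho]-\operatorname{tr}[R_i\sqrt\rho R_i\sqrt\rho]\Bigr).$$ 2. If $\rho=\sigma$, equality holds in this inequality. Moreover the identity channel is an optimal transport plan from $\sigma$ to $\sigma$: it is a transport plan, $\pi_{\mathrm{id}}$ is a coupling of $\sigma$ with itself, $\operatorname{tr}[C\pi_{\mathrm{id}}]=D(\sigma,\sigma)^2$, and $\operatorname{tr}[C\pi_{\mathrm{id}}]\le\operatorname{tr}[C\pi_\Phi]$ for every transport plan $\Phi$ from $\sigma$ to $\sigma$. 3. For all states $\rho,\sigma$ on $X$, $\ D(\rho,\sigma)^2\ge\tfrac12 D(\rho,\rho)^2+\tfrac12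 D(\sigma,\sigma)^2$. -/

import Mathlib

open scoped Kronecker ComplexOrder MatrixOrder

/-!
Finite dimensional quantum systems are written in a fixed orthonormal basis: for finite index types
`m`, `n`, the operators on `Y = ℂ^m` and `X = ℂ^n` are the complex matrices indexed by `m` and `n`.
The dual space `X*` carries the dual basis, so that the transpose operator on `X*` has the
transposed matrix, and operators on `Y ⊗ X*` are matrices indexed by `m × n`.
-/

namespace QuantumTransport

noncomputable section

variable {m n k : Type*} [Fintype m] [Fintype n] [Fintype k]
  [DecidableEq m] [DecidableEq n] [DecidableEq k]

/-- A state (density operator): a positive semidefinite operator of unit trace. -/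
def IsState (σ : Matrix n n ℂ) : Prop :=
  σ.PosSemidef ∧ σ.trace = 1

/-- The partial trace over the first factor of a composite system. -/
def partialTraceFst (A : Matrix (m × n) (m × n) ℂ) : Matrix n n ℂ :=
  Matrix.of fun j l => ∑ i, A (i, j) (i, l)

/-- The partial trace over the second factor of a composite system. -/
def partialTraceSnd (A : Matrix (m × n) (m × n) ℂ) : Matrix m m ℂ :=
  Matrix.of fun i k => ∑ j, A (i, j) (k, j)

/-- A quantum coupling between a state `σ` on `X` and a state `ρ` on `Y` is a state `π` on `Y ⊗ X*`
with `tr_Y π = σᵀ` and `tr_{X*} π = ρ`. -/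
def IsCoupling (σ : Matrix n n ℂ) (ρ : Matrix m m ℂ) (π : Matrix (m × n) (m × n) ℂ) : Prop :=
  IsState π ∧ partialTraceFst π = σ.transpose ∧ partialTraceSnd π = ρ

/-- The map `Φ ⊗ id`, which applies `Φ` to the first factor: it is the linear map that sends
`A ⊗ B` to `Φ A ⊗ B`. -/
def ampliate (k : Type*) (Φ : Matrix m m ℂ →ₗ[ℂ] Matrix n n ℂ) (A : Matrix (m × k) (m × k) ℂ) :
    Matrix (n × k) (n × k) ℂ :=
  Matrix.of fun p q => Φ (Matrix.of fun i j => A (i, p.2) (j, q.2)) p.1 q.1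

/-- A quantum channel: a completely positive and trace preserving linear map. -/
def IsChannel (Φ : Matrix m m ℂ →ₗ[ℂ] Matrix n n ℂ) : Prop :=
  (∀ (r : ℕ) (A : Matrix (m × Fin r) (m × Fin r) ℂ),
      A.PosSemidef → (ampliate (Fin r) Φ A).PosSemidef) ∧
    ∀ A : Matrix m m ℂ, (Φ A).trace = A.trace

/-- A quantum transport plan from `σ` to `ρ`: a quantum channel that maps `σ` to `ρ`. -/
def IsPlan (σ : Matrix m m ℂ) (ρ : Matrix n n ℂ) (Φ : Matrix m m ℂ →ₗ[ℂ] Matrix n n ℂ) : Prop :=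
  IsChannel Φ ∧ Φ σ = ρ

/-- The canonical purification of `σ`: the vector of `X ⊗ X*` that corresponds to the operator `√σ`
under the identification of `|φ⟩ ⊗ ⟨ψ|` with the operator `|φ⟩⟨ψ|`. -/
def purification (σ : Matrix n n ℂ) : n × n → ℂ :=
  fun p => CFC.sqrt σ p.1 p.2

/-- The operator `π_Φ = (Φ ⊗ id) |Ψ⟩⟨Ψ|` on `Y ⊗ X*`, where `Ψ` is the canonical purification
of `σ`. -/
def planCoupling (σ : Matrix n n ℂ) (Φ : Matrix n n ℂ →ₗ[ℂ] Matrix m m ℂ) :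
    Matrix (m × n) (m × n) ℂ :=
  ampliate n Φ (Matrix.vecMulVec (purification σ) (star (purification σ)))

/-- The quadratic cost operator `C = ∑ i, (R i ⊗ 1 - 1 ⊗ (R i)ᵀ) ^ 2` on `X ⊗ X*`. -/
def costOperator {d : ℕ} (R : Fin d → Matrix n n ℂ) : Matrix (n × n) (n × n) ℂ :=
  ∑ i, (R i ⊗ₖ (1 : Matrix n n ℂ) - (1 : Matrix n n ℂ) ⊗ₖ (R i).transpose) ^ 2

/-- The average cost `tr[C π]` (a real number when `π` and the `R i` are self-adjoint). -/
def averageCost {d : ℕ} (R : Fin d → Matrix n n ℂ) (π : Matrix (n × n) (n × n) ℂ) : ℝ :=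
  (costOperator R * π).trace.re

/-- The average costs of all quantum couplings between `σ` and `ρ`. -/
def couplingCosts {d : ℕ} (R : Fin d → Matrix n n ℂ) (σ ρ : Matrix n n ℂ) : Set ℝ :=
  {c | ∃ π : Matrix (n × n) (n × n) ℂ, IsCoupling σ ρ π ∧ averageCost R π = c}

/-- The transport cost `D(σ, ρ)`: the nonnegative square root of the minimal average cost over all
quantum couplings between `σ` and `ρ`. -/
def transportDist {d : ℕ} (R : Fin d → Matrix n n ℂ) (σ ρ : Matrix n n ℂ) : ℝ :=
  Real.sqrt (sInf (couplingCosts R σ ρ))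

end

end QuantumTransport

/-!
A coupling `π` of `σ` and `ρ` is a sum of rank one operators `|A k⟩⟨A k|`, where the vectors of
`X ⊗ X*` are read as matrices `A k`. Then `ρ = ∑ A k (A k)ᴴ`, `σ = ∑ (A k)ᴴ A k`, and by
`averageCost_eq` the average cost of `π` is
`∑ i, (tr[R i ² σ] + tr[R i ² ρ] - 2 ∑ k, tr[(A k)ᴴ R i (A k) R i])`.
The lower bound is therefore the inequality (`two_mul_sum_trace_le`)
`2 Re ∑ tr[(A k)ᴴ R (A k) R] ≤ tr[R √σ R √σ] + tr[R √ρ R √ρ]`.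

With the Hermitian block matrices `B k = [[0, (A k)ᴴ], [A k, 0]]`, whose squares add up to
`τ = σ ⊕ ρ`, and with `X = R ⊕ R`, this inequality becomes (`sum_trace_le_trace_sqrt`)
`Re ∑ tr[Xᴴ (B k) X (B k)] ≤ tr[Xᴴ √τ X √τ]`, a form of the Wigner–Yanase–Lieb concavity theorem.
To prove it, diagonalise `τ = diag(t)`. By the Cauchy–Schwarz inequality the Hermitian
superoperator `M : Y ↦ ∑ (B k) Y (B k)` satisfies
`|⟨X, M Y⟩|² ≤ (∑ t i |X i j|²) (∑ t j |Y i j|²)`. Such a bound by two commuting weights `p` and `q`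
implies the bound `⟨X, M X⟩ ≤ ∑ √(p q) |X|²` by their geometric mean
(`dotProduct_le_of_nonneg`): an eigenvector `M y = λ √(p q) y`, tested against `√(q / p) y`, shows
that `λ² ≤ 1`.

The minimum is attained because the couplings form a nonempty compact set. For the identity channel
the single matrix `A = √σ` represents the coupling, and the lower bound becomes an equality; every
transport plan induces a coupling, so the identity is optimal. The inequality for two states is
the lower bound combined with the equality for each of them.
-/

namespace QuantumTransport

open Matrix

/-! ### Quadratic forms bounded by two weights -/

/-- If a Hermitian form `⟨x, M y⟩` is bounded by the weights `p` in `x` and `q` in `y`, then its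
quadratic form is bounded by the geometric mean of the weights. The claim says that the matrix
`1 - E M E` with `E = (p q) ^ (-1/4)` is positive semidefinite, as seen from its eigenvalues. -/
theorem dotProduct_le_of_pos {ι : Type*} [Fintype ι] [DecidableEq ι]
    {M : Matrix ι ι ℂ} (hM : M.IsHermitian) {p q : ι → ℝ} (hp : ∀ i, 0 < p i) (hq : ∀ i, 0 < q i)
    (h : ∀ x y : ι → ℂ, ‖star x ⬝ᵥ M *ᵥ y‖ ^ 2 ≤ (∑ i, p i * ‖x i‖ ^ 2) * ∑ i, q i * ‖y i‖ ^ 2)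
    (x : ι → ℂ) : (star x ⬝ᵥ M *ᵥ x).re ≤ ∑ i, √(p i * q i) * ‖x i‖ ^ 2 := by
  set e : ι → ℝ := fun i => √√(p i * q i) with he
  have he0 : ∀ i, 0 < e i := fun i => Real.sqrt_pos.2 (Real.sqrt_pos.2 (mul_pos (hp i) (hq i)))
  have he2 : ∀ i, e i ^ 2 = √(p i * q i) := fun i => Real.sq_sqrt (Real.sqrt_nonneg _)
  set E : Matrix ι ι ℂ := diagonal fun i => ((e i)⁻¹ : ℂ) with hE
  have hEH : Eᴴ = E := by
    rw [hE, diagonal_conjTranspose]; congr 1; ext i; simp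
  set N : Matrix ι ι ℂ := E * M * E with hN
  have hNH : N.IsHermitian := by
    have := isHermitian_mul_mul_conjTranspose E hM
    rwa [hEH] at this
  have hG : (1 - N).IsHermitian := isHermitian_one.sub hNH
  have hpsd : (1 - N).PosSemidef := by
    rw [hG.posSemidef_iff_eigenvalues_nonneg]
    intro j
    set μ := hG.eigenvalues j
    set v : ι → ℂ := ⇑(hG.eigenvectorBasis j) with hv
    have hNv : N *ᵥ v = ((1 - μ : ℝ) : ℂ) • v := by
      have h1 := hG.mulVec_eigenvectorBasis j
      rw [sub_mulVec, one_mulVec, sub_eq_iff_eq_add, ← sub_eq_iff_eq_add'] at h1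
      rw [← h1]; ext i; simp [μ]; ring
    have hv0 : ∃ i, v i ≠ 0 := by
      by_contra! hc
      apply hG.eigenvectorBasis.orthonormal.ne_zero j
      ext i; exact hc i
    -- In the eigenvector equation `M y = λ √(p q) y` the bound is tested against `√(q / p) y`.
    set y : ι → ℂ := fun i => ((e i)⁻¹ : ℂ) * v i with hy
    have hyE : y = E *ᵥ v := by ext i; simp [hE, hy, mulVec_diagonal]
    have hMy : ∀ i, (M *ᵥ y) i = ((1 - μ : ℝ) : ℂ) * (((e i) ^ 2 : ℝ) : ℂ) * y i := by
      intro i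
      have h1 := congrFun hNv i
      rw [hN, ← mulVec_mulVec, ← mulVec_mulVec, ← hyE, hE, mulVec_diagonal] at h1
      have : ((e i : ℝ) : ℂ) ≠ 0 := by exact_mod_cast (he0 i).ne'
      have h2 : (M *ᵥ y) i = e i * (((1 - μ : ℝ) : ℂ) * v i) := by
        rw [← smul_eq_mul (a := ((1 - μ : ℝ) : ℂ)), ← Pi.smul_apply, ← h1]; field_simp
      rw [h2]; simp only [hy]; push_cast; field_simp
    set x' : ι → ℂ := fun i => ((√(q i / p i) : ℝ) : ℂ) * y i with hx'
    set Q := ∑ i, q i * ‖y i‖ ^ 2 with hQ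
    have hQ0 : 0 < Q := by
      obtain ⟨i, hi⟩ := hv0
      refine Finset.sum_pos' (fun i _ => by have := (hq i).le; positivity)
        ⟨i, Finset.mem_univ _, mul_pos (hq i) (pow_pos (norm_pos_iff.2 ?_) 2)⟩
      exact mul_ne_zero (inv_ne_zero (by exact_mod_cast (he0 i).ne')) hi
    have hpx : ∑ i, p i * ‖x' i‖ ^ 2 = Q := by
      refine Finset.sum_congr rfl fun i _ => ?_
      have := (hp i).ne'
      rw [hx', norm_mul, mul_pow, Complex.norm_real, Real.norm_eq_abs, sq_abs,
        Real.sq_sqrt (div_pos (hq i) (hp i)).le]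
      field_simp
    have hxy : star x' ⬝ᵥ M *ᵥ y = (((1 - μ) * Q : ℝ) : ℂ) := by
      rw [dotProduct, hQ, Finset.mul_sum, Complex.ofReal_sum]
      refine Finset.sum_congr rfl fun i _ => ?_
      have h1 : √(q i / p i) * e i ^ 2 = q i := by
        rw [he2, ← Real.sqrt_mul (div_pos (hq i) (hp i)).le,
          show q i / p i * (p i * q i) = q i ^ 2 by have := (hp i).ne'; field_simp,
          Real.sqrt_sq (hq i).le]
      have h2 : star (y i) * y i = ((‖y i‖ ^ 2 : ℝ) : ℂ) := by
        rw [Complex.star_def, Complex.conj_mul']; push_cast; rfl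
      rw [hMy, Pi.star_apply, hx', star_mul', Complex.star_def, Complex.conj_ofReal]
      rw [Complex.star_def] at h2
      have h1' : ((√(q i / p i) : ℝ) : ℂ) * (e i : ℂ) ^ 2 = q i := by exact_mod_cast h1
      push_cast at h2 ⊢
      linear_combination (√(q i / p i) * (1 - μ) * e i ^ 2 : ℂ) * h2 +
        (1 - μ) * (‖y i‖ : ℂ) ^ 2 * h1'
    have h3 := h x' y
    rw [hpx, hxy, Complex.norm_real, Real.norm_eq_abs, sq_abs, mul_pow, ← hQ] at h3
    have h4 : (1 - μ) ^ 2 ≤ 1 := by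
      have : 0 < Q ^ 2 := by positivity
      nlinarith
    show 0 ≤ μ
    nlinarith
  -- Positivity of `1 - N` at `w = E⁻¹ x` is the claim.
  set w : ι → ℂ := fun i => e i * x i with hw
  have hEw : E *ᵥ w = x := by
    ext i
    have : ((e i : ℝ) : ℂ) ≠ 0 := by exact_mod_cast (he0 i).ne'
    simp [hE, hw, mulVec_diagonal]; field_simp
  have h5 := hpsd.re_dotProduct_nonneg w
  have h6 : star w ⬝ᵥ N *ᵥ w = star x ⬝ᵥ M *ᵥ x := by
    rw [hN, ← mulVec_mulVec, ← mulVec_mulVec, hEw, dotProduct_mulVec, ← hEw, star_mulVec, hEH]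
  have h7 : star w ⬝ᵥ w = ((∑ i, √(p i * q i) * ‖x i‖ ^ 2 : ℝ) : ℂ) := by
    rw [dotProduct, Complex.ofReal_sum]
    refine Finset.sum_congr rfl fun i _ => ?_
    rw [Pi.star_apply, Complex.star_def, Complex.conj_mul', hw, norm_mul, Complex.norm_real,
      Real.norm_eq_abs, ← he2]
    rw [← Complex.ofReal_pow, mul_pow, sq_abs]
  rw [sub_mulVec, one_mulVec, dotProduct_sub, h6, h7] at h5
  simp only [RCLike.re_to_complex, Complex.sub_re, Complex.ofReal_re] at h5
  linarith

/-- The bound by the geometric mean for weights that may vanish, as the limit of the bounds for the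
weights `p + ε` and `q + ε`. -/
theorem dotProduct_le_of_nonneg {ι : Type*} [Fintype ι] [DecidableEq ι]
    {M : Matrix ι ι ℂ} (hM : M.IsHermitian) {p q : ι → ℝ} (hp : ∀ i, 0 ≤ p i) (hq : ∀ i, 0 ≤ q i)
    (h : ∀ x y : ι → ℂ, ‖star x ⬝ᵥ M *ᵥ y‖ ^ 2 ≤ (∑ i, p i * ‖x i‖ ^ 2) * ∑ i, q i * ‖y i‖ ^ 2)
    (x : ι → ℂ) : (star x ⬝ᵥ M *ᵥ x).re ≤ ∑ i, √(p i * q i) * ‖x i‖ ^ 2 := by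
  have hc : Continuous fun ε : ℝ => ∑ i, √((p i + ε) * (q i + ε)) * ‖x i‖ ^ 2 := by fun_prop
  have ht : Filter.Tendsto (fun ε : ℝ => ∑ i, √((p i + ε) * (q i + ε)) * ‖x i‖ ^ 2)
      (nhdsWithin 0 (Set.Ioi 0)) (nhds (∑ i, √(p i * q i) * ‖x i‖ ^ 2)) := by
    simpa using (hc.tendsto 0).mono_left nhdsWithin_le_nhds
  refine ge_of_tendsto ht ?_
  filter_upwards [self_mem_nhdsWithin] with ε hε
  have hε : 0 < ε := hε
  refine dotProduct_le_of_pos hM (fun i => add_pos_of_nonneg_of_pos (hp i) hε)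
    (fun i => add_pos_of_nonneg_of_pos (hq i) hε) (fun x y => (h x y).trans ?_) x
  have := hε.le
  gcongr <;> first | exact Finset.sum_nonneg fun i _ => by have := hp i; have := hq i; positivity
                   | linarith

/-! ### Superoperators and the Hilbert–Schmidt inner product -/

theorem trace_conjTranspose_mul_self_re {m n : Type*} [Fintype m] [Fintype n]
    (A : Matrix m n ℂ) : (Aᴴ * A).trace.re = ∑ p : m × n, ‖A p.1 p.2‖ ^ 2 := by
  rw [Fintype.sum_prod_type_right, trace, Complex.re_sum]
  refine Finset.sum_congr rfl fun j _ => ?_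
  rw [diag_apply, mul_apply, Complex.re_sum]
  refine Finset.sum_congr rfl fun i _ => ?_
  rw [conjTranspose_apply, Complex.star_def, Complex.conj_mul', ← Complex.ofReal_pow,
    Complex.ofReal_re]

/-- The Cauchy–Schwarz inequality for families of matrices with the Hilbert–Schmidt inner
product. -/
theorem norm_sum_trace_sq_le {κ m n : Type*} [Fintype κ] [Fintype m] [Fintype n]
    (A C : κ → Matrix m n ℂ) :
    ‖∑ k, ((A k)ᴴ * C k).trace‖ ^ 2 ≤
      (∑ k, ((A k)ᴴ * A k).trace.re) * ∑ k, ((C k)ᴴ * C k).trace.re := by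
  simp only [trace_conjTranspose_mul_self_re]
  rw [← Fintype.sum_prod_type' (f := fun k (p : m × n) => ‖A k p.1 p.2‖ ^ 2),
    ← Fintype.sum_prod_type' (f := fun k (p : m × n) => ‖C k p.1 p.2‖ ^ 2)]
  have h : ∑ k, ((A k)ᴴ * C k).trace
      = ∑ s : κ × m × n, star (A s.1 s.2.1 s.2.2) * C s.1 s.2.1 s.2.2 := by
    rw [Fintype.sum_prod_type]
    refine Finset.sum_congr rfl fun k _ => ?_
    rw [Fintype.sum_prod_type_right]
    rfl
  rw [h]
  refine le_trans ?_ (Finset.sum_mul_sq_le_sq_mul_sq _ _ _)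
  gcongr
  refine (norm_sum_le _ _).trans (le_of_eq ?_)
  simp

/-- Under the identification of vectors indexed by `n × n` with matrices, `B ⊗ Bᵀ` is the
superoperator `Y ↦ B Y B`. -/
theorem vec_dotProduct {n : Type*} [Fintype n] (X Y B : Matrix n n ℂ) :
    star (fun p : n × n => X p.1 p.2) ⬝ᵥ (B ⊗ₖ Bᵀ) *ᵥ (fun p : n × n => Y p.1 p.2)
      = (Xᴴ * B * Y * B).trace := by
  have h : ∀ i j, ((B ⊗ₖ Bᵀ) *ᵥ (fun p : n × n => Y p.1 p.2)) (i, j) = (B * Y * B) i j := by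
    intro i j
    rw [mulVec, dotProduct, Fintype.sum_prod_type_right, mul_apply]
    refine Finset.sum_congr rfl fun l _ => ?_
    rw [mul_apply, Finset.sum_mul]
    refine Finset.sum_congr rfl fun k _ => ?_
    simp only [kroneckerMap_apply, transpose_apply]; ring
  rw [dotProduct, Fintype.sum_prod_type_right, show Xᴴ * B * Y * B = Xᴴ * (B * Y * B) by
    simp only [Matrix.mul_assoc], trace]
  refine Finset.sum_congr rfl fun j _ => ?_
  rw [diag_apply, mul_apply]
  refine Finset.sum_congr rfl fun i _ => ?_
  rw [h]; rfl

/-- The case of `sum_trace_le_trace_sqrt` in which `∑ k, B k * B k` is diagonal. Here the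
superoperators of left and right multiplication by that sum are the two weights. -/
theorem sum_trace_le_of_diagonal {κ n : Type*} [Fintype κ] [Fintype n] [DecidableEq n]
    {B : κ → Matrix n n ℂ} (hB : ∀ k, (B k).IsHermitian) {t : n → ℝ} (ht : ∀ i, 0 ≤ t i)
    (h : ∑ k, B k * B k = diagonal fun i => (t i : ℂ)) (X : Matrix n n ℂ) :
    (∑ k, (Xᴴ * B k * X * B k).trace).re ≤
      (Xᴴ * (diagonal fun i => ((√(t i) : ℝ) : ℂ)) * X *
        diagonal fun i => ((√(t i) : ℝ) : ℂ)).trace.re := by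
  have hM : (∑ k, B k ⊗ₖ (B k)ᵀ).IsHermitian := by
    rw [IsHermitian, conjTranspose_sum]
    refine Finset.sum_congr rfl fun k _ => ?_
    rw [conjTranspose_kronecker, (hB k).eq, (hB k).transpose.eq]
  have hMd : ∀ X Y : Matrix n n ℂ,
      star (fun p : n × n => X p.1 p.2) ⬝ᵥ (∑ k, B k ⊗ₖ (B k)ᵀ) *ᵥ (fun p : n × n => Y p.1 p.2)
        = ∑ k, (Xᴴ * B k * Y * B k).trace := by
    intro X Y
    rw [sum_mulVec, dotProduct_sum]
    exact Finset.sum_congr rfl fun k _ => vec_dotProduct X Y (B k)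
  have hdiag : ∀ (u v : n → ℝ) (X : Matrix n n ℂ),
      (Xᴴ * (diagonal fun i => (u i : ℂ)) * X * diagonal fun i => (v i : ℂ)).trace.re
        = ∑ p : n × n, u p.1 * v p.2 * ‖X p.1 p.2‖ ^ 2 := by
    intro u v X
    rw [Fintype.sum_prod_type_right, trace, Complex.re_sum]
    refine Finset.sum_congr rfl fun j _ => ?_
    rw [diag_apply, mul_diagonal, mul_apply, Finset.sum_mul, Complex.re_sum]
    refine Finset.sum_congr rfl fun i _ => ?_
    rw [mul_diagonal, conjTranspose_apply, Complex.star_def,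
      show (starRingEnd ℂ) (X i j) * u i * X i j * v j
        = u i * v j * ((starRingEnd ℂ) (X i j) * X i j) by ring, Complex.conj_mul']
    norm_cast
  have key := dotProduct_le_of_nonneg hM (p := fun p => t p.1) (q := fun p => t p.2)
    (fun p => ht _) (fun p => ht _) ?_ (fun p : n × n => X p.1 p.2)
  · rw [hMd] at key
    rw [hdiag]
    refine key.trans (le_of_eq (Finset.sum_congr rfl fun p _ => ?_))
    rw [Real.sqrt_mul (ht _)]
  · intro x y
    have h1 := hMd (of fun i j => x (i, j)) (of fun i j => y (i, j))
    simp only [of_apply, Prod.mk.eta] at h1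
    rw [h1]
    set X : Matrix n n ℂ := of fun i j => x (i, j)
    set Y : Matrix n n ℂ := of fun i j => y (i, j)
    -- `tr[Xᴴ B Y B]` is the inner product of `B X` with `Y B`.
    have h2 := norm_sum_trace_sq_le (fun k => B k * X) (fun k => Y * B k)
    have h3 : ∑ k, ((B k * X)ᴴ * (B k * X)).trace.re = ∑ p, t p.1 * ‖x p‖ ^ 2 := by
      have : ∀ k, (B k * X)ᴴ * (B k * X) = Xᴴ * (B k * B k) * X := fun k => by
        rw [conjTranspose_mul, (hB k).eq]; simp only [Matrix.mul_assoc]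
      simp only [this]
      rw [← Complex.re_sum, ← trace_sum, ← Finset.sum_mul, ← Finset.mul_sum, h]
      have := hdiag t (fun _ => 1) X
      simpa [X] using this
    have h4 : ∑ k, ((Y * B k)ᴴ * (Y * B k)).trace.re = ∑ p, t p.2 * ‖y p‖ ^ 2 := by
      have : ∀ k, ((Y * B k)ᴴ * (Y * B k)).trace = (Yᴴ * Y * (B k * B k)).trace := fun k => by
        rw [conjTranspose_mul, (hB k).eq, Matrix.mul_assoc, trace_mul_comm]
        simp only [Matrix.mul_assoc]
      simp only [this]
      rw [← Complex.re_sum, ← trace_sum, ← Finset.mul_sum, h]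
      have := hdiag (fun _ => 1) t Y
      simpa [Y] using this
    rw [h3, h4] at h2
    simpa only [conjTranspose_mul, (hB _).eq, Matrix.mul_assoc] using h2

/-! ### Trace inequalities with matrix square roots -/

theorem sqrt_mul_self_of_posSemidef {n : Type*} [Fintype n] [DecidableEq n] {τ : Matrix n n ℂ}
    (hτ : τ.PosSemidef) : CFC.sqrt τ * CFC.sqrt τ = τ :=
  CFC.sqrt_mul_sqrt_self τ (nonneg_iff_posSemidef.2 hτ)

theorem sqrt_eq_of_mul_self {n : Type*} [Fintype n] [DecidableEq n] {τ s : Matrix n n ℂ}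
    (hs : s.PosSemidef) (h : s * s = τ) : CFC.sqrt τ = s :=
  CFC.sqrt_unique h (nonneg_iff_posSemidef.2 hs)

/-- A form of the Wigner–Yanase–Lieb concavity theorem: the superoperator `X ↦ ∑ k, B k * X * B k`
is bounded by the geometric mean `X ↦ √τ X √τ` of the left and right multiplications by
`τ = ∑ k, B k * B k`. -/
theorem sum_trace_le_trace_sqrt {κ n : Type*} [Fintype κ] [Fintype n] [DecidableEq n]
    {B : κ → Matrix n n ℂ} (hB : ∀ k, (B k).IsHermitian) (X : Matrix n n ℂ) :
    (∑ k, (Xᴴ * B k * X * B k).trace).re ≤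
      (Xᴴ * CFC.sqrt (∑ k, B k * B k) * X * CFC.sqrt (∑ k, B k * B k)).trace.re := by
  set τ := ∑ k, B k * B k with hτd
  have hτ : τ.PosSemidef := posSemidef_sum _ fun k _ => by
    simpa only [(hB k).eq] using posSemidef_conjTranspose_mul_self (B k)
  set U : Matrix n n ℂ := hτ.1.eigenvectorUnitary.1 with hU
  have hUU : Uᴴ * U = 1 := Unitary.coe_star_mul_self hτ.1.eigenvectorUnitary
  have hUU' : U * Uᴴ = 1 := Unitary.coe_mul_star_self hτ.1.eigenvectorUnitary
  set t := hτ.1.eigenvalues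
  have ht : ∀ i, 0 ≤ t i := hτ.eigenvalues_nonneg
  have hspec : τ = U * (diagonal fun i => (t i : ℂ)) * Uᴴ := by
    conv_lhs => rw [hτ.1.spectral_theorem, Unitary.conjStarAlgAut_apply]
    rfl
  set s : Matrix n n ℂ := diagonal fun i => ((√(t i) : ℝ) : ℂ) with hs
  have hssq : s * s = diagonal fun i => (t i : ℂ) := by
    rw [hs, diagonal_mul_diagonal]
    congr 1; ext i
    rw [← Complex.ofReal_mul, Real.mul_self_sqrt (ht i)]
  have hspos : s.PosSemidef := PosSemidef.diagonal fun i => by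
    simp
  have cancel : ∀ Z : Matrix n n ℂ, U * (Uᴴ * Z) = Z := fun Z => by
    rw [← Matrix.mul_assoc, hUU', Matrix.one_mul]
  have cancel' : ∀ Z : Matrix n n ℂ, Uᴴ * (U * Z) = Z := fun Z => by
    rw [← Matrix.mul_assoc, hUU, Matrix.one_mul]
  have hsqrt : CFC.sqrt τ = U * s * Uᴴ := by
    refine sqrt_eq_of_mul_self (hspos.mul_mul_conjTranspose_same U) ?_
    rw [hspec, ← hssq]
    simp only [Matrix.mul_assoc, cancel']
  have key := sum_trace_le_of_diagonal (B := fun k => Uᴴ * B k * U) (t := t)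
    (fun k => isHermitian_conjTranspose_mul_mul U (hB k)) ht ?_ (Uᴴ * X * U)
  · rw [hsqrt]
    have h1 : ∀ k, ((Uᴴ * X * U)ᴴ * (Uᴴ * B k * U) * (Uᴴ * X * U) * (Uᴴ * B k * U)).trace
        = (Xᴴ * B k * X * B k).trace := by
      intro k
      simp only [conjTranspose_mul, conjTranspose_conjTranspose, Matrix.mul_assoc, cancel]
      rw [trace_mul_comm]
      simp only [Matrix.mul_assoc, hUU', Matrix.mul_one]
    have h2 : ((Uᴴ * X * U)ᴴ * s * (Uᴴ * X * U) * s).trace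
        = (Xᴴ * (U * s * Uᴴ) * X * (U * s * Uᴴ)).trace := by
      simp only [conjTranspose_mul, conjTranspose_conjTranspose, Matrix.mul_assoc]
      rw [trace_mul_comm]
      simp only [Matrix.mul_assoc]
    rw [← hs, h2] at key
    simp only [h1] at key
    exact key
  -- In the eigenbasis the squares still add up to the diagonal form of `τ`.
  · have : ∀ k, Uᴴ * B k * U * (Uᴴ * B k * U) = Uᴴ * (B k * B k) * U := fun k => by
      simp only [Matrix.mul_assoc, cancel]
    simp only [this]
    rw [← Finset.sum_mul, ← Finset.mul_sum, ← hτd, hspec]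
    simp only [Matrix.mul_assoc, cancel', hUU, Matrix.mul_one]

theorem trace_fromBlocks_eq {m n : Type*} [Fintype m] [Fintype n] (A : Matrix m m ℂ)
    (B : Matrix m n ℂ) (C : Matrix n m ℂ) (D : Matrix n n ℂ) :
    (fromBlocks A B C D).trace = A.trace + D.trace := by
  simp [trace, Fintype.sum_sum_type]

/-- The version of `sum_trace_le_trace_sqrt` for matrices that need not be Hermitian or square,
obtained from the Hermitian dilations `[[0, (A k)ᴴ], [A k, 0]]`. -/
theorem two_mul_sum_trace_le {κ m n : Type*} [Fintype κ] [Fintype m] [Fintype n]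
    [DecidableEq m] [DecidableEq n] (A : κ → Matrix m n ℂ) {R : Matrix n n ℂ} {S : Matrix m m ℂ}
    (hR : R.IsHermitian) (hS : S.IsHermitian) :
    2 * (∑ k, ((A k)ᴴ * S * A k * R).trace).re ≤
      (R * CFC.sqrt (∑ k, (A k)ᴴ * A k) * R * CFC.sqrt (∑ k, (A k)ᴴ * A k)).trace.re +
      (S * CFC.sqrt (∑ k, A k * (A k)ᴴ) * S * CFC.sqrt (∑ k, A k * (A k)ᴴ)).trace.re := by
  set σ := ∑ k, (A k)ᴴ * A k with hσd
  set ρ := ∑ k, A k * (A k)ᴴ with hρd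
  have hσ : σ.PosSemidef := posSemidef_sum _ fun k _ => posSemidef_conjTranspose_mul_self (A k)
  have hρ : ρ.PosSemidef := posSemidef_sum _ fun k _ => posSemidef_self_mul_conjTranspose (A k)
  have hB : ∀ k, (fromBlocks 0 (A k)ᴴ (A k) 0).IsHermitian := fun k => by
    simp [IsHermitian, fromBlocks_conjTranspose]
  have key := sum_trace_le_trace_sqrt hB (fromBlocks R 0 0 S)
  have hτ : ∑ k, fromBlocks 0 (A k)ᴴ (A k) 0 * fromBlocks 0 (A k)ᴴ (A k) 0
      = fromBlocks σ 0 0 ρ := by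
    ext i j
    rw [Matrix.sum_apply]
    rcases i with i | i <;> rcases j with j | j <;>
      simp [fromBlocks_multiply, hσd, hρd, Matrix.sum_apply]
  have hsqrt : CFC.sqrt (fromBlocks σ 0 0 ρ)
      = fromBlocks (CFC.sqrt σ) 0 0 (CFC.sqrt ρ) := by
    refine sqrt_eq_of_mul_self ?_ ?_
    · have h1 : (CFC.sqrt σ).PosSemidef := nonneg_iff_posSemidef.1 (CFC.sqrt_nonneg σ)
      have h2 : (CFC.sqrt ρ).PosSemidef := nonneg_iff_posSemidef.1 (CFC.sqrt_nonneg ρ)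
      rw [posSemidef_iff_dotProduct_mulVec]
      refine ⟨by simp [IsHermitian, fromBlocks_conjTranspose, h1.1.eq, h2.1.eq], fun x => ?_⟩
      have := add_nonneg (h1.dotProduct_mulVec_nonneg (x ∘ Sum.inl))
        (h2.dotProduct_mulVec_nonneg (x ∘ Sum.inr))
      simpa [fromBlocks_mulVec, dotProduct, Fintype.sum_sum_type] using this
    · simp [fromBlocks_multiply, sqrt_mul_self_of_posSemidef hσ, sqrt_mul_self_of_posSemidef hρ]
  rw [hτ, hsqrt] at key
  have h1 : ∀ k, (R * (A k)ᴴ * S * A k).trace = ((A k)ᴴ * S * A k * R).trace := fun k => by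
    rw [trace_mul_comm _ R]; simp only [Matrix.mul_assoc]
  have h2 : ∀ k, (S * A k * R * (A k)ᴴ).trace = ((A k)ᴴ * S * A k * R).trace := fun k => by
    rw [trace_mul_comm _ (A k)ᴴ]; simp only [Matrix.mul_assoc]
  simp only [fromBlocks_conjTranspose, conjTranspose_zero, hR.eq, hS.eq, fromBlocks_multiply,
    Matrix.mul_zero, Matrix.zero_mul, add_zero, zero_add, trace_fromBlocks_eq, h1, h2,
    Complex.add_re, Finset.sum_add_distrib] at key
  linarith

/-! ### Partial traces and the average cost -/

theorem trace_partialTraceSnd {m n : Type*} [Fintype m] [Fintype n]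
    (π : Matrix (m × n) (m × n) ℂ) : (partialTraceSnd π).trace = π.trace := by
  simp [trace, partialTraceSnd, Fintype.sum_prod_type]

theorem trace_kronecker_one_mul {m n : Type*} [Fintype m] [Fintype n] [DecidableEq n]
    (A : Matrix m m ℂ) (π : Matrix (m × n) (m × n) ℂ) :
    ((A ⊗ₖ (1 : Matrix n n ℂ)) * π).trace = (A * partialTraceSnd π).trace := by
  simp only [trace, diag_apply, mul_apply, partialTraceSnd, of_apply, Fintype.sum_prod_type,
    kroneckerMap_apply, one_apply, mul_ite, mul_one, mul_zero, ite_mul, zero_mul,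
    Finset.sum_ite_eq, Finset.mem_univ, if_true, Finset.mul_sum]
  exact Finset.sum_congr rfl fun i _ => Finset.sum_comm

theorem trace_one_kronecker_mul {m n : Type*} [Fintype m] [Fintype n] [DecidableEq m]
    (B : Matrix n n ℂ) (π : Matrix (m × n) (m × n) ℂ) :
    (((1 : Matrix m m ℂ) ⊗ₖ B) * π).trace = (B * partialTraceFst π).trace := by
  simp only [trace, diag_apply, mul_apply, partialTraceFst, of_apply, Fintype.sum_prod_type_right,
    kroneckerMap_apply, one_apply, ite_mul, one_mul, zero_mul,
    Finset.sum_ite_eq, Finset.mem_univ, if_true, Finset.mul_sum]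
  exact Finset.sum_congr rfl fun i _ => Finset.sum_comm

/-- The average cost of a coupling depends on the coupling itself only through the expectation of
the cross terms `R i ⊗ (R i)ᵀ`; the square terms are determined by the marginals. -/
theorem averageCost_eq {n : Type*} [Fintype n] [DecidableEq n] {d : ℕ} (R : Fin d → Matrix n n ℂ)
    {σ ρ : Matrix n n ℂ} {π : Matrix (n × n) (n × n) ℂ} (hfst : partialTraceFst π = σᵀ)
    (hsnd : partialTraceSnd π = ρ) :
    averageCost R π = ∑ i, ((R i ^ 2 * σ).trace.re + (R i ^ 2 * ρ).trace.re
      - 2 * ((R i ⊗ₖ (R i)ᵀ) * π).trace.re) := by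
  rw [averageCost, costOperator, Finset.sum_mul, trace_sum, Complex.re_sum]
  refine Finset.sum_congr rfl fun i _ => ?_
  have h : (R i ⊗ₖ (1 : Matrix n n ℂ) - (1 : Matrix n n ℂ) ⊗ₖ (R i)ᵀ) ^ 2
      = (R i ^ 2) ⊗ₖ (1 : Matrix n n ℂ) + (1 : Matrix n n ℂ) ⊗ₖ ((R i ^ 2)ᵀ)
        - (2 : ℂ) • (R i ⊗ₖ (R i)ᵀ) := by
    rw [sq, sub_mul, mul_sub, mul_sub]
    simp only [← mul_kronecker_mul, Matrix.one_mul, Matrix.mul_one, sq, transpose_mul, two_smul]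
    abel
  rw [h, sub_mul, add_mul, trace_sub, trace_add, trace_kronecker_one_mul, trace_one_kronecker_mul,
    hfst, hsnd, ← transpose_mul, trace_transpose, trace_mul_comm σ, smul_mul, trace_smul]
  simp
  ring

/-! ### Rank one decompositions and the lower bound -/

theorem partialTraceFst_vecMulVec {n : Type*} [Fintype n] (A : Matrix n n ℂ) :
    partialTraceFst (vecMulVec (fun p : n × n => A p.1 p.2) (star fun p : n × n => A p.1 p.2))
      = (Aᴴ * A)ᵀ := by
  ext j l
  simp [partialTraceFst, vecMulVec_apply, mul_apply, mul_comm]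

theorem partialTraceSnd_vecMulVec {n : Type*} [Fintype n] (A : Matrix n n ℂ) :
    partialTraceSnd (vecMulVec (fun p : n × n => A p.1 p.2) (star fun p : n × n => A p.1 p.2))
      = A * Aᴴ := by
  ext j l
  simp [partialTraceSnd, vecMulVec_apply, mul_apply]

theorem partialTraceFst_sum {κ n : Type*} [Fintype κ] [Fintype n]
    (π : κ → Matrix (n × n) (n × n) ℂ) :
    partialTraceFst (∑ k, π k) = ∑ k, partialTraceFst (π k) := by
  ext j l
  simp only [partialTraceFst, of_apply, Matrix.sum_apply]
  exact Finset.sum_comm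

theorem partialTraceSnd_sum {κ n : Type*} [Fintype κ] [Fintype n]
    (π : κ → Matrix (n × n) (n × n) ℂ) :
    partialTraceSnd (∑ k, π k) = ∑ k, partialTraceSnd (π k) := by
  ext j l
  simp only [partialTraceSnd, of_apply, Matrix.sum_apply]
  exact Finset.sum_comm

theorem trace_kronecker_transpose_mul_vecMulVec {n : Type*} [Fintype n] (R A : Matrix n n ℂ) :
    ((R ⊗ₖ Rᵀ) * vecMulVec (fun p : n × n => A p.1 p.2) (star fun p : n × n => A p.1 p.2)).trace
      = (Aᴴ * R * A * R).trace := by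
  rw [mul_vecMulVec, trace_vecMulVec, dotProduct_comm, vec_dotProduct]

/-- Every positive semidefinite operator is a sum of rank one operators: the columns of its square
root serve as vectors, each read as a matrix. -/
theorem exists_eq_sum_vecMulVec {n : Type*} [Fintype n] [DecidableEq n]
    {π : Matrix (n × n) (n × n) ℂ} (hπ : π.PosSemidef) :
    ∃ A : n × n → Matrix n n ℂ, π = ∑ k,
      vecMulVec (fun p : n × n => A k p.1 p.2) (star fun p : n × n => A k p.1 p.2) := by
  refine ⟨fun k => of fun i j => CFC.sqrt π (i, j) k, ?_⟩
  have hs : (CFC.sqrt π).PosSemidef := nonneg_iff_posSemidef.1 (CFC.sqrt_nonneg π)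
  ext p q
  conv_lhs => rw [← sqrt_mul_self_of_posSemidef hπ, mul_apply]
  rw [Matrix.sum_apply]
  refine Finset.sum_congr rfl fun k _ => ?_
  rw [vecMulVec_apply, ← hs.1.apply k q]
  rfl

/-- The expectation of a cross term in any coupling is controlled by the marginals. -/
theorem two_mul_trace_kronecker_transpose_mul_le {n : Type*} [Fintype n] [DecidableEq n]
    {R : Matrix n n ℂ} (hR : R.IsHermitian) {σ ρ : Matrix n n ℂ} {π : Matrix (n × n) (n × n) ℂ}
    (hπ : IsCoupling σ ρ π) :
    2 * ((R ⊗ₖ Rᵀ) * π).trace.re ≤ (R * CFC.sqrt σ * R * CFC.sqrt σ).trace.re +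
      (R * CFC.sqrt ρ * R * CFC.sqrt ρ).trace.re := by
  obtain ⟨⟨hpos, -⟩, hfst, hsnd⟩ := hπ
  obtain ⟨A, rfl⟩ := exists_eq_sum_vecMulVec hpos
  simp only [partialTraceFst_sum, partialTraceFst_vecMulVec, ← transpose_sum] at hfst
  simp only [partialTraceSnd_sum, partialTraceSnd_vecMulVec] at hsnd
  have h := two_mul_sum_trace_le A hR hR
  rw [hsnd, transpose_injective hfst] at h
  simpa only [Finset.mul_sum, trace_sum, trace_kronecker_transpose_mul_vecMulVec] using h

theorem le_averageCost {n : Type*} [Fintype n] [DecidableEq n] {d : ℕ}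
    {R : Fin d → Matrix n n ℂ} (hR : ∀ i, (R i).IsHermitian) {σ ρ : Matrix n n ℂ}
    {π : Matrix (n × n) (n × n) ℂ} (hπ : IsCoupling σ ρ π) :
    ∑ i, ((R i ^ 2 * σ).trace.re - (R i * CFC.sqrt σ * R i * CFC.sqrt σ).trace.re
        + (R i ^ 2 * ρ).trace.re - (R i * CFC.sqrt ρ * R i * CFC.sqrt ρ).trace.re)
      ≤ averageCost R π := by
  rw [averageCost_eq R hπ.2.1 hπ.2.2]
  refine Finset.sum_le_sum fun i _ => ?_
  have := two_mul_trace_kronecker_transpose_mul_le (hR i) hπ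
  linarith

/-! ### Existence of optimal couplings -/

theorem averageCost_nonneg {n : Type*} [Fintype n] [DecidableEq n] {d : ℕ}
    {R : Fin d → Matrix n n ℂ} (hR : ∀ i, (R i).IsHermitian)
    {π : Matrix (n × n) (n × n) ℂ} (hπ : π.PosSemidef) : 0 ≤ averageCost R π := by
  rw [averageCost, costOperator, Finset.sum_mul, trace_sum, Complex.re_sum]
  refine Finset.sum_nonneg fun i _ => ?_
  -- `tr[H² π] = tr[H π Hᴴ]` for the Hermitian difference `H`.
  set H := R i ⊗ₖ (1 : Matrix n n ℂ) - (1 : Matrix n n ℂ) ⊗ₖ (R i)ᵀ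
  have hH : Hᴴ = H := by
    simp only [H, conjTranspose_sub, conjTranspose_kronecker, (hR i).eq, (hR i).transpose.eq,
      conjTranspose_one]
  have h : (H ^ 2 * π).trace = (H * π * Hᴴ).trace := by
    rw [hH, trace_mul_comm (H * π), sq, Matrix.mul_assoc]
  rw [h]
  exact (Complex.le_def.1 (hπ.mul_mul_conjTranspose_same H).trace_nonneg).1

/-- The product state is a coupling, so couplings exist. -/
theorem isCoupling_kronecker_transpose {n : Type*} [Fintype n] [DecidableEq n]
    {σ ρ : Matrix n n ℂ} (hσ : IsState σ) (hρ : IsState ρ) : IsCoupling σ ρ (ρ ⊗ₖ σᵀ) := by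
  refine ⟨⟨hρ.1.kronecker hσ.1.transpose, ?_⟩, ?_, ?_⟩
  · rw [trace_kronecker, trace_transpose, hσ.2, hρ.2, one_mul]
  · ext j l
    have : ∑ i, ρ i i = 1 := hρ.2
    simp [partialTraceFst, ← Finset.sum_mul, this]
  · ext j l
    have : ∑ i, σ i i = 1 := hσ.2
    simp [partialTraceSnd, ← Finset.mul_sum, this]

/-- The entries of a positive semidefinite matrix are bounded by its trace, so the set of states is
bounded. -/
theorem norm_apply_le_trace_re {ι : Type*} [Fintype ι] [DecidableEq ι] {π : Matrix ι ι ℂ}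
    (hπ : π.PosSemidef) (p q : ι) : ‖π p q‖ ≤ π.trace.re := by
  set s := CFC.sqrt π
  have hs : s.PosSemidef := nonneg_iff_posSemidef.1 (CFC.sqrt_nonneg π)
  have hπs : s * s = π := sqrt_mul_self_of_posSemidef hπ
  have h1 : π.trace.re = ∑ i, ∑ k, ‖s k i‖ ^ 2 := by
    rw [← Fintype.sum_prod_type_right' (f := fun k i => ‖s k i‖ ^ 2),
      ← trace_conjTranspose_mul_self_re, hs.1.eq, hπs]
  have h2 : ∀ i, ∑ k, ‖s k i‖ ^ 2 ≤ π.trace.re := fun i => by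
    rw [h1]
    exact Finset.single_le_sum (f := fun i => ∑ k, ‖s k i‖ ^ 2) (fun i _ => by positivity)
      (Finset.mem_univ i)
  have h3 : ‖π p q‖ ≤ ∑ k, ‖s k p‖ * ‖s k q‖ := by
    rw [← hπs, mul_apply]
    refine (norm_sum_le _ _).trans (le_of_eq (Finset.sum_congr rfl fun k _ => ?_))
    rw [norm_mul, ← hs.1.apply p k, norm_star]
  have h4 : ∑ k, ‖s k p‖ * ‖s k q‖ ≤ ∑ k, (‖s k p‖ ^ 2 + ‖s k q‖ ^ 2) / 2 :=
    Finset.sum_le_sum fun k _ => by nlinarith [sq_nonneg (‖s k p‖ - ‖s k q‖)]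
  rw [← Finset.sum_div, Finset.sum_add_distrib] at h4
  linarith [h2 p, h2 q]

theorem isClosed_setOf_posSemidef {ι : Type*} [Fintype ι] :
    IsClosed {π : Matrix ι ι ℂ | π.PosSemidef} := by
  simp only [posSemidef_iff_dotProduct_mulVec, Set.ofPred_and, Set.ofPred_forall, IsHermitian]
  refine (isClosed_eq (by fun_prop) continuous_id).inter (isClosed_iInter fun x => ?_)
  exact isClosed_le continuous_const (by fun_prop)

theorem isCompact_setOf_isCoupling {n : Type*} [Fintype n] [DecidableEq n] (σ ρ : Matrix n n ℂ) :
    IsCompact {π : Matrix (n × n) (n × n) ℂ | IsCoupling σ ρ π} := by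
  have hK : IsCompact (Set.univ.pi fun _ : n × n => Set.univ.pi fun _ : n × n =>
      Metric.closedBall (0 : ℂ) 1) :=
    isCompact_univ_pi fun _ => isCompact_univ_pi fun _ => isCompact_closedBall _ _
  refine IsCompact.of_isClosed_subset hK ?_ ?_
  · have h1 : Continuous fun π : Matrix (n × n) (n × n) ℂ => partialTraceFst π :=
      continuous_matrix fun j l => continuous_finsetSum _ fun i _ => by fun_prop
    have h2 : Continuous fun π : Matrix (n × n) (n × n) ℂ => partialTraceSnd π :=
      continuous_matrix fun j l => continuous_finsetSum _ fun i _ => by fun_prop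
    exact (isClosed_setOf_posSemidef.inter (isClosed_eq (by fun_prop) continuous_const)).inter
      ((isClosed_eq h1 continuous_const).inter (isClosed_eq h2 continuous_const))
  · intro π hπ p _ q _
    have h := norm_apply_le_trace_re hπ.1.1 p q
    rw [hπ.1.2, Complex.one_re] at h
    simpa using h

theorem isLeast_couplingCosts {n : Type*} [Fintype n] [DecidableEq n] {d : ℕ}
    {R : Fin d → Matrix n n ℂ} (hR : ∀ i, (R i).IsHermitian) {σ ρ : Matrix n n ℂ}
    (hσ : IsState σ) (hρ : IsState ρ) :
    IsLeast (couplingCosts R σ ρ) (transportDist R σ ρ ^ 2) := by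
  have himg : couplingCosts R σ ρ = averageCost R '' {π | IsCoupling σ ρ π} := rfl
  have hcont : Continuous (averageCost R) := by
    unfold averageCost
    exact Complex.continuous_re.comp (by fun_prop)
  have hcpt : IsCompact (couplingCosts R σ ρ) :=
    himg ▸ (isCompact_setOf_isCoupling σ ρ).image hcont
  have hne : (couplingCosts R σ ρ).Nonempty :=
    ⟨_, _, isCoupling_kronecker_transpose hσ hρ, rfl⟩
  have h0 : 0 ≤ sInf (couplingCosts R σ ρ) := by
    refine Real.sInf_nonneg ?_
    rintro _ ⟨π, hπ, rfl⟩
    exact averageCost_nonneg hR hπ.1.1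
  rw [transportDist, Real.sq_sqrt h0]
  exact hcpt.isLeast_sInf hne

/-! ### Couplings induced by channels -/

theorem ampliate_id {m k : Type*} (A : Matrix (m × k) (m × k) ℂ) :
    ampliate k (LinearMap.id : Matrix m m ℂ →ₗ[ℂ] Matrix m m ℂ) A = A := rfl

theorem isPlan_id {n : Type*} [Fintype n] (σ : Matrix n n ℂ) : IsPlan σ σ LinearMap.id :=
  ⟨⟨fun _ _ hA => hA, fun _ => rfl⟩, rfl⟩

/-- Complete positivity, which `IsChannel` requires for the ancillas `Fin r`, holds for ancillas
with any finite index type. -/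
theorem IsChannel.posSemidef_ampliate {m n k : Type*} [Fintype m] [Fintype n] [Fintype k]
    {Φ : Matrix m m ℂ →ₗ[ℂ] Matrix n n ℂ} (hΦ : IsChannel Φ) {A : Matrix (m × k) (m × k) ℂ}
    (hA : A.PosSemidef) : (ampliate k Φ A).PosSemidef := by
  have e := Fintype.equivFin k
  have h := (hΦ.1 _ _ (hA.submatrix (Prod.map id e.symm))).submatrix (Prod.map id e)
  convert h using 1
  ext p q
  simp [ampliate]

theorem IsChannel.partialTraceFst_ampliate {m n k : Type*} [Fintype m] [Fintype n]
    {Φ : Matrix m m ℂ →ₗ[ℂ] Matrix n n ℂ} (hΦ : IsChannel Φ) (A : Matrix (m × k) (m × k) ℂ) :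
    partialTraceFst (ampliate k Φ A) = partialTraceFst A := by
  ext j l
  exact hΦ.2 (of fun i i' => A (i, j) (i', l))

theorem partialTraceSnd_ampliate {m n k : Type*} [Fintype k]
    (Φ : Matrix m m ℂ →ₗ[ℂ] Matrix n n ℂ) (A : Matrix (m × k) (m × k) ℂ) :
    partialTraceSnd (ampliate k Φ A) = Φ (partialTraceSnd A) := by
  have h : partialTraceSnd A = ∑ j, of fun i i' => A (i, j) (i', j) := by
    ext i i'
    simp [partialTraceSnd, Matrix.sum_apply]
  ext i i'
  rw [h, map_sum, Matrix.sum_apply]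
  rfl

theorem IsPlan.isCoupling_planCoupling {n : Type*} [Fintype n] [DecidableEq n]
    {σ ρ : Matrix n n ℂ} (hσ : IsState σ) {Φ : Matrix n n ℂ →ₗ[ℂ] Matrix n n ℂ}
    (hΦ : IsPlan σ ρ Φ) : IsCoupling σ ρ (planCoupling σ Φ) := by
  have hs : (CFC.sqrt σ).IsHermitian := (nonneg_iff_posSemidef.1 (CFC.sqrt_nonneg σ)).1
  have hfst : partialTraceFst (planCoupling σ Φ) = σᵀ := by
    rw [planCoupling, hΦ.1.partialTraceFst_ampliate]
    refine (partialTraceFst_vecMulVec (CFC.sqrt σ)).trans ?_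
    rw [hs.eq, sqrt_mul_self_of_posSemidef hσ.1]
  have hsnd : partialTraceSnd (planCoupling σ Φ) = ρ := by
    rw [planCoupling, partialTraceSnd_ampliate, ← hΦ.2]
    congr 1
    refine (partialTraceSnd_vecMulVec (CFC.sqrt σ)).trans ?_
    rw [hs.eq, sqrt_mul_self_of_posSemidef hσ.1]
  refine ⟨⟨hΦ.1.posSemidef_ampliate (posSemidef_vecMulVec_self_star _), ?_⟩, hfst, hsnd⟩
  rw [← trace_partialTraceSnd, hsnd, ← hΦ.2, hΦ.1.2, hσ.2]

/-- The coupling of the identity channel attains the lower bound for `ρ = σ`. -/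
theorem averageCost_planCoupling_id {n : Type*} [Fintype n] [DecidableEq n] {d : ℕ}
    (R : Fin d → Matrix n n ℂ) {σ : Matrix n n ℂ} (hσ : IsState σ) :
    averageCost R (planCoupling σ LinearMap.id) =
      ∑ i, ((R i ^ 2 * σ).trace.re - (R i * CFC.sqrt σ * R i * CFC.sqrt σ).trace.re
        + (R i ^ 2 * σ).trace.re - (R i * CFC.sqrt σ * R i * CFC.sqrt σ).trace.re) := by
  have hs : (CFC.sqrt σ).IsHermitian := (nonneg_iff_posSemidef.1 (CFC.sqrt_nonneg σ)).1
  have hπ := (isPlan_id σ).isCoupling_planCoupling hσ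
  rw [averageCost_eq R hπ.2.1 hπ.2.2]
  refine Finset.sum_congr rfl fun i _ => ?_
  have h : ((R i ⊗ₖ (R i)ᵀ) * planCoupling σ LinearMap.id).trace
      = (R i * CFC.sqrt σ * R i * CFC.sqrt σ).trace := by
    rw [planCoupling, ampliate_id]
    refine (trace_kronecker_transpose_mul_vecMulVec (R i) (CFC.sqrt σ)).trans ?_
    rw [hs.eq, trace_mul_comm]
    simp only [Matrix.mul_assoc]
  rw [h]
  ring

end QuantumTransport

theorem mainTheorem3 {n : Type*} [Fintype n] [DecidableEq n] {d : ℕ}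
    (R : Fin d → Matrix n n ℂ) (hR : ∀ i, (R i).IsHermitian) :
    -- the minimum that defines `D(σ, ρ)²` is attained, and the lower bound holds
    (∀ σ ρ : Matrix n n ℂ, QuantumTransport.IsState σ → QuantumTransport.IsState ρ →
      IsLeast (QuantumTransport.couplingCosts R σ ρ) (QuantumTransport.transportDist R σ ρ ^ 2) ∧
      ∑ i, ((R i ^ 2 * σ).trace.re - (R i * CFC.sqrt σ * R i * CFC.sqrt σ).trace.re
          + (R i ^ 2 * ρ).trace.re - (R i * CFC.sqrt ρ * R i * CFC.sqrt ρ).trace.re)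
        ≤ QuantumTransport.transportDist R σ ρ ^ 2) ∧
    -- equality for `σ = ρ`, and optimality of the identity channel
    (∀ σ : Matrix n n ℂ, QuantumTransport.IsState σ →
      QuantumTransport.transportDist R σ σ ^ 2 =
        ∑ i, ((R i ^ 2 * σ).trace.re - (R i * CFC.sqrt σ * R i * CFC.sqrt σ).trace.re
          + (R i ^ 2 * σ).trace.re - (R i * CFC.sqrt σ * R i * CFC.sqrt σ).trace.re) ∧
      QuantumTransport.IsPlan σ σ LinearMap.id ∧
      QuantumTransport.IsCoupling σ σ (QuantumTransport.planCoupling σ LinearMap.id) ∧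
      QuantumTransport.averageCost R (QuantumTransport.planCoupling σ LinearMap.id) =
        QuantumTransport.transportDist R σ σ ^ 2 ∧
      ∀ Φ : Matrix n n ℂ →ₗ[ℂ] Matrix n n ℂ, QuantumTransport.IsPlan σ σ Φ →
        QuantumTransport.averageCost R (QuantumTransport.planCoupling σ LinearMap.id) ≤
          QuantumTransport.averageCost R (QuantumTransport.planCoupling σ Φ)) ∧
    -- the consequence for two states
    (∀ ρ σ : Matrix n n ℂ, QuantumTransport.IsState ρ → QuantumTransport.IsState σ →
      1 / 2 * QuantumTransport.transportDist R ρ ρ ^ 2 + 1 / 2 * QuantumTransport.transportDist R σ σ ^ 2 ≤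
        QuantumTransport.transportDist R ρ σ ^ 2) := by
  have hbound : ∀ σ ρ : Matrix n n ℂ, QuantumTransport.IsState σ → QuantumTransport.IsState ρ →
      ∑ i, ((R i ^ 2 * σ).trace.re - (R i * CFC.sqrt σ * R i * CFC.sqrt σ).trace.re
          + (R i ^ 2 * ρ).trace.re - (R i * CFC.sqrt ρ * R i * CFC.sqrt ρ).trace.re)
        ≤ QuantumTransport.transportDist R σ ρ ^ 2 := by
    intro σ ρ hσ hρ
    obtain ⟨π, hπ, hcost⟩ := (QuantumTransport.isLeast_couplingCosts hR hσ hρ).1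
    exact (QuantumTransport.le_averageCost hR hπ).trans_eq hcost
  have hid : ∀ σ : Matrix n n ℂ, QuantumTransport.IsState σ →
      QuantumTransport.averageCost R (QuantumTransport.planCoupling σ LinearMap.id) =
        QuantumTransport.transportDist R σ σ ^ 2 := by
    intro σ hσ
    refine le_antisymm ?_ ((QuantumTransport.isLeast_couplingCosts hR hσ hσ).2
      ⟨_, (QuantumTransport.isPlan_id σ).isCoupling_planCoupling hσ, rfl⟩)
    rw [QuantumTransport.averageCost_planCoupling_id R hσ]
    exact hbound σ σ hσ hσ
  refine ⟨fun σ ρ hσ hρ => ⟨QuantumTransport.isLeast_couplingCosts hR hσ hρ, hbound σ ρ hσ hρ⟩,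
    fun σ hσ => ⟨?_, QuantumTransport.isPlan_id σ,
      (QuantumTransport.isPlan_id σ).isCoupling_planCoupling hσ, hid σ hσ, fun Φ hΦ => ?_⟩,
    fun ρ σ hρ hσ => ?_⟩
  · rw [← hid σ hσ, QuantumTransport.averageCost_planCoupling_id R hσ]
  · rw [hid σ hσ]
    exact (QuantumTransport.isLeast_couplingCosts hR hσ hσ).2
      ⟨_, hΦ.isCoupling_planCoupling hσ, rfl⟩
  · rw [← hid ρ hρ, ← hid σ hσ, QuantumTransport.averageCost_planCoupling_id R hρ,
      QuantumTransport.averageCost_planCoupling_id R hσ]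
    refine le_trans (le_of_eq ?_) (hbound ρ σ hρ hσ)
    rw [Finset.mul_sum, Finset.mul_sum, ← Finset.sum_add_distrib]
    exact Finset.sum_congr rfl fun i _ => by ring
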